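/- Let $d\ge 1$ and let $A,B$ be quantum systems of dimension $d$ with fixed orthonormal (incoherent) bases $\{|i\rangle\}_{i=0}^{d-1}$; $AB$ carries the product basis. $\Delta$ denotes the dephasing channel $\Delta(X)=\sum_i \langle i|X|i\rangle\,|i\rangle\langle i|$ in the incoherent basis. A channel (completely positive trace-preserving map) $\mathcal K$ is a detection-incoherent operation (DIO) if $\Delta\circ\mathcal K=\Delta\circ\mathcal K\circ\Delta$, and it is unital if $\mathcal K(I)=I$. Let $\overline{\mathrm{LOCC}}(A{:}B)$ be the closure of the set of LOCC channels on $AB$, where an LOCC channel is a finite composition of one-way LOCC channels, with arbitrary finite-dimensional intermediate local systems. Given a set $\mathbf F$ of free channels, call a function $f$ from channels to extended real numbers an $\mathbf F$-monotone if, for all channels $\mathcal E,\mathcal G$: (i) $f(\mathcal E)\ge 0$, and $f(\mathcal E)=0$ if and only if $\mathcal E\in\mathbf F$; (ii) $f(\mathcal K\circ\mathcal E\circ\mathcal L)\le f(\mathcal E)$ for every $\mathcal K\in\mathbf F$ and every unital $\mathcal L\in\mathbf F$; (iii) $f(p\,\mathcal E+(1-p)\,\mathcal G)\le p f(\mathcal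 E)+(1-p)f(\mathcal G)$ for $0\le p\le 1$. A measurement-entangling-power monotone is an $\overline{\mathrm{LOCC}}(A{:}B)$-monotone on channels of $AB$, and a measurement-cohering-power monotone is a DIO-monotone on channels of $A$. **Theorem.** Let $\widetilde E$ be a measurement-entangling-power monotone. For a channel $\mathcal E_A$ on $A$ put $$\widetilde C(\mathcal E_A)=\sup_{\mathcal K_{AB},\,\mathcal L_{AB}}\widetilde E\bigl(\Delta_{AB}\circ\mathcal K_{AB}\circ(\mathcal E_A\otimes\mathrm{id}_B)\circ\mathcal L_{AB}\bigr),$$ where $\mathcal K_{AB}$ ranges over the DIO and $\mathcal L_{AB}$ over the unital DIO on $AB$. Then $\widetilde C$ is a measurement-cohering-power monotone: it is non-negative, zero exactly on DIO, monotone under $\mathcal E_A\mapsto\mathcal K_A\circ\mathcal E_A\circ\mathcal L_A$ with $\mathcal K_A$ DIO and $\mathcal L_A$ unital DIO, and convex. Moreover, if $\widetilde E$ is upper semicontinuous on the set of channels, then the supremum is a maximum for every channel $\mathcal E_A$. -/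

import Mathlib

open scoped ComplexOrder Kronecker

/-- Operators on the finite-dimensional space with orthonormal (incoherent) basis indexed by `a`. -/
abbrev Op (a : Type) := Matrix a a ℂ

/-- Linear maps between operator spaces. -/
abbrev SuperOp (a b : Type) := Op a →ₗ[ℂ] Op b

/-- The tensor product `Φ ⊗ Ψ`: the linear extension of `E_ij ⊗ E_kl ↦ Φ(E_ij) ⊗ Ψ(E_kl)`,
with `E_ij` the matrix units. -/
noncomputable def tensorMap {a b a' b' : Type} [Fintype a] [DecidableEq a] [Fintype b]
    [DecidableEq b] (Φ : SuperOp a a') (Ψ : SuperOp b b') : SuperOp (a × b) (a' × b') where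
  toFun X := ∑ i, ∑ j, ∑ k, ∑ l,
    X (i, k) (j, l) • (Φ (Matrix.single i j 1) ⊗ₖ Ψ (Matrix.single k l 1))
  map_add' X Y := by
    simp only [Matrix.add_apply, add_smul, Finset.sum_add_distrib]
  map_smul' c X := by
    simp only [Matrix.smul_apply, smul_eq_mul, mul_smul, Finset.smul_sum, RingHom.id_apply]

/-- Complete positivity: `Φ ⊗ id` preserves positive semidefiniteness for each ancilla. -/
def IsCP {a b : Type} [Fintype a] [DecidableEq a] (Φ : SuperOp a b) : Prop :=
  ∀ (k : ℕ) (X : Op (a × Fin k)), X.PosSemidef →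
    (tensorMap Φ (LinearMap.id : SuperOp (Fin k) (Fin k)) X).PosSemidef

/-- Quantum channels: completely positive, trace-preserving linear maps. -/
def IsChannel {a b : Type} [Fintype a] [DecidableEq a] [Fintype b] (Φ : SuperOp a b) : Prop :=
  IsCP Φ ∧ ∀ X : Op a, (Φ X).trace = X.trace

/-- A map is unital if it sends the identity operator to the identity operator. -/
def IsUnital {a : Type} [DecidableEq a] (Φ : SuperOp a a) : Prop :=
  Φ 1 = 1

/-- The dephasing channel `Δ(X) = ∑ i, ⟨i|X|i⟩ |i⟩⟨i|` of the incoherent basis. -/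
def dephasing (a : Type) [DecidableEq a] : SuperOp a a where
  toFun X := Matrix.diagonal fun i => X i i
  map_add' X Y := by
    ext i j
    by_cases h : i = j <;> simp [Matrix.diagonal, h]
  map_smul' c X := by
    ext i j
    by_cases h : i = j <;> simp [Matrix.diagonal, h]

/-- Detection-incoherent operations: channels with `Δ ∘ Φ = Δ ∘ Φ ∘ Δ`. -/
def IsDIO {a : Type} [Fintype a] [DecidableEq a] (Φ : SuperOp a a) : Prop :=
  IsChannel Φ ∧ dephasing a ∘ₗ Φ = dephasing a ∘ₗ Φ ∘ₗ dephasing a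

/-- One-way LOCC with communication from the first party to the second one: the first party
applies an instrument `(Φ x)` and the second one a channel `Ψ x` that depends on the outcome. -/
def IsOneWayRight {a b a' b' : Type} [Fintype a] [DecidableEq a] [Fintype b] [DecidableEq b]
    [Fintype a'] [Fintype b'] (Ξ : SuperOp (a × b) (a' × b')) : Prop :=
  ∃ (σ : Type) (_ : Fintype σ) (Φ : σ → SuperOp a a') (Ψ : σ → SuperOp b b'),
    (∀ x, IsCP (Φ x)) ∧ IsChannel (∑ x, Φ x) ∧ (∀ x, IsChannel (Ψ x)) ∧
      Ξ = ∑ x, tensorMap (Φ x) (Ψ x)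

/-- One-way LOCC with communication from the second party to the first one. -/
def IsOneWayLeft {a b a' b' : Type} [Fintype a] [DecidableEq a] [Fintype b] [DecidableEq b]
    [Fintype a'] [Fintype b'] (Ξ : SuperOp (a × b) (a' × b')) : Prop :=
  ∃ (σ : Type) (_ : Fintype σ) (Φ : σ → SuperOp a a') (Ψ : σ → SuperOp b b'),
    (∀ x, IsChannel (Φ x)) ∧ (∀ x, IsCP (Ψ x)) ∧ IsChannel (∑ x, Ψ x) ∧
      Ξ = ∑ x, tensorMap (Φ x) (Ψ x)

/-- LOCC channels: finite compositions of one-way LOCC channels, through arbitrary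
finite-dimensional intermediate local systems. -/
inductive IsLOCC : {a b a' b' : Type} → [Fintype a] → [DecidableEq a] → [Fintype b] →
    [DecidableEq b] → [Fintype a'] → [DecidableEq a'] → [Fintype b'] → [DecidableEq b'] →
    SuperOp (a × b) (a' × b') → Prop
  | right {a b a' b' : Type} [Fintype a] [DecidableEq a] [Fintype b] [DecidableEq b]
      [Fintype a'] [DecidableEq a'] [Fintype b'] [DecidableEq b']
      (Ξ : SuperOp (a × b) (a' × b')) : IsOneWayRight Ξ → IsLOCC Ξ
  | left {a b a' b' : Type} [Fintype a] [DecidableEq a] [Fintype b] [DecidableEq b]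
      [Fintype a'] [DecidableEq a'] [Fintype b'] [DecidableEq b']
      (Ξ : SuperOp (a × b) (a' × b')) : IsOneWayLeft Ξ → IsLOCC Ξ
  | comp {a b a' b' a'' b'' : Type} [Fintype a] [DecidableEq a] [Fintype b] [DecidableEq b]
      [Fintype a'] [DecidableEq a'] [Fintype b'] [DecidableEq b']
      [Fintype a''] [DecidableEq a''] [Fintype b''] [DecidableEq b'']
      (Ξ : SuperOp (a × b) (a' × b')) (Ξ' : SuperOp (a' × b') (a'' × b'')) :
      IsLOCC Ξ → IsLOCC Ξ' → IsLOCC (Ξ' ∘ₗ Ξ)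

/-- Convergence of a sequence of linear maps between (finite-dimensional) operator spaces. -/
def MapsTendTo {a b : Type} (Φs : ℕ → SuperOp a b) (Φ : SuperOp a b) : Prop :=
  ∀ X : Op a, Filter.Tendsto (fun n => Φs n X) Filter.atTop (nhds (Φ X))

/-- The closure of the set of LOCC channels on a bipartite system. -/
def IsClosedLOCC {a b : Type} [Fintype a] [DecidableEq a] [Fintype b] [DecidableEq b]
    (Φ : SuperOp (a × b) (a × b)) : Prop :=
  ∃ Φs : ℕ → SuperOp (a × b) (a × b), (∀ n, IsLOCC (Φs n)) ∧ MapsTendTo Φs Φ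

/-- `f` is a monotone for channels on the system `a`, with respect to a class `Free` of free
channels. Only the values of `f` at channels matter; the value `+∞` is allowed. -/
structure IsPowerMonotone {a : Type} [Fintype a] [DecidableEq a] (Free : SuperOp a a → Prop)
    (f : SuperOp a a → EReal) : Prop where
  nonneg : ∀ Φ, IsChannel Φ → 0 ≤ f Φ
  faithful : ∀ Φ, IsChannel Φ → (f Φ = 0 ↔ Free Φ)
  monotone : ∀ Φ K L, IsChannel Φ → Free K → Free L → IsUnital L → f (K ∘ₗ Φ ∘ₗ L) ≤ f Φ
  convex : ∀ Φ Γ, IsChannel Φ → IsChannel Γ → ∀ p : ℝ, 0 ≤ p → p ≤ 1 →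
    f ((p : ℂ) • Φ + ((1 - p : ℝ) : ℂ) • Γ) ≤ (p : EReal) * f Φ + ((1 - p : ℝ) : EReal) * f Γ

/-- Measurement-entangling-power monotones, for two systems of dimension `d`. -/
def IsMeasEntanglingMonotone (d : ℕ) (E : SuperOp (Fin d × Fin d) (Fin d × Fin d) → EReal) :
    Prop :=
  IsPowerMonotone IsClosedLOCC E

/-- Measurement-cohering-power monotones, for a system of dimension `d`. -/
def IsMeasCoheringMonotone (d : ℕ) (C : SuperOp (Fin d) (Fin d) → EReal) : Prop :=
  IsPowerMonotone IsDIO C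

/-- Upper semicontinuity on the set of channels. -/
def IsUSCOnChannels {a : Type} [Fintype a] [DecidableEq a] (f : SuperOp a a → EReal) : Prop :=
  ∀ (Φs : ℕ → SuperOp a a) (Φ : SuperOp a a), (∀ n, IsChannel (Φs n)) → IsChannel Φ →
    MapsTendTo Φs Φ → Filter.limsup (fun n => f (Φs n)) Filter.atTop ≤ f Φ

/-- The values `E(Δ_AB ∘ K_AB ∘ (Φ_A ⊗ id_B) ∘ L_AB)` for a detection-incoherent `K` and a unital
detection-incoherent `L`. -/
def inducedValues (d : ℕ) (E : SuperOp (Fin d × Fin d) (Fin d × Fin d) → EReal)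
    (Φ : SuperOp (Fin d) (Fin d)) : Set EReal :=
  {v | ∃ K L : SuperOp (Fin d × Fin d) (Fin d × Fin d), IsDIO K ∧ IsDIO L ∧ IsUnital L ∧
    v = E (dephasing (Fin d × Fin d) ∘ₗ K ∘ₗ
      tensorMap Φ (LinearMap.id : SuperOp (Fin d) (Fin d)) ∘ₗ L)}

/-- The induced power: the supremum of `inducedValues` (their maximum, when there is one). -/
noncomputable def inducedPower (d : ℕ) (E : SuperOp (Fin d × Fin d) (Fin d × Fin d) → EReal)
    (Φ : SuperOp (Fin d) (Fin d)) : EReal :=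
  sSup (inducedValues d E Φ)

/-! The point with content is faithfulness. If `Φ` is DIO, so is `K ∘ (Φ ⊗ id) ∘ L`. Dephasing its
output makes it blind to input coherence, so it is a stochastic map between basis labels, and two
parties can realise it by measuring, communicating and sampling (`IsDIO.isLOCC_dephasing_comp`).
Hence every induced value vanishes. Conversely, vanishing values put every `Δ ∘ (Φ ⊗ id) ∘ L` in the
closure of LOCC; `K = id` and basis permutations `L` suffice. LOCC maps keep operators nonnegative
on product vectors, and so have nonnegative diagonal output on entanglement witnesses. A controlled
swap turns a suitable witness into one whose output diagonal exposes `⟨k|Φ(|i⟩⟨j|)|k⟩` with an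
arbitrary phase; nonnegativity for all phases forces this number to be zero
(`isDIO_of_isClosedLOCC`). Monotonicity holds because the outer operations, tensored with the
identity, are absorbed in `K` and `L`; convexity, because the composite is linear in `Φ`. The
maximum comes from sequential compactness of the DIO and unital DIO sets (`exists_subseq_mapsTendTo`
and closedness under limits). -/

/-! ### Tensor products of linear maps. -/

section Tensor

theorem single_pair_eq_kronecker {a b : Type} [DecidableEq a] [DecidableEq b] (i j : a)
    (k l : b) (c : ℂ) :
    Matrix.single (i, k) (j, l) c = Matrix.single i j c ⊗ₖ Matrix.single k l 1 := by
  rw [Matrix.single_kronecker_single, mul_one]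

variable {a b a' b' : Type} [Fintype a] [DecidableEq a] [Fintype b] [DecidableEq b]

/-- Matrix units of the product system are Kronecker products, so identities of tensor maps need
checking on products only. -/
theorem linearMap_ext_kronecker {M : Type*} [AddCommMonoid M] [Module ℂ M]
    {F G : Op (a × b) →ₗ[ℂ] M} (h : ∀ A B, F (A ⊗ₖ B) = G (A ⊗ₖ B)) : F = G := by
  refine Matrix.ext_linearMap ℂ fun ⟨i, k⟩ ⟨j, l⟩ => LinearMap.ext fun c => ?_
  simpa [single_pair_eq_kronecker] using h (Matrix.single i j c) (Matrix.single k l 1)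

theorem superOp_apply_eq_sum (Φ : SuperOp a a') (X : Op a) :
    Φ X = ∑ i, ∑ j, X i j • Φ (Matrix.single i j 1) := by
  conv_lhs => rw [Matrix.matrix_eq_sum_single X]
  simp only [map_sum]
  refine Finset.sum_congr rfl fun i _ => Finset.sum_congr rfl fun j _ => ?_
  rw [← map_smul, Matrix.smul_single, smul_eq_mul, mul_one]

theorem tensorMap_kronecker (Φ : SuperOp a a') (Ψ : SuperOp b b') (A : Op a) (B : Op b) :
    tensorMap Φ Ψ (A ⊗ₖ B) = Φ A ⊗ₖ Ψ B := by
  rw [superOp_apply_eq_sum Φ A, superOp_apply_eq_sum Ψ B]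
  ext ⟨x, y⟩ ⟨x', y'⟩
  simp only [tensorMap, LinearMap.coe_mk, AddHom.coe_mk, Matrix.kroneckerMap_apply,
    Matrix.sum_apply, Matrix.smul_apply, smul_eq_mul]
  simp only [Finset.sum_mul]
  simp only [Finset.mul_sum]
  refine Finset.sum_congr rfl fun i _ => Finset.sum_congr rfl fun j _ =>
    Finset.sum_congr rfl fun k _ => Finset.sum_congr rfl fun l _ => ?_
  ring

theorem tensorMap_comp {a'' b'' : Type} [Fintype a'] [DecidableEq a'] [Fintype b'] [DecidableEq b']
    (Φ : SuperOp a a') (Ψ : SuperOp b b') (Φ' : SuperOp a' a'') (Ψ' : SuperOp b' b'') :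
    tensorMap (Φ' ∘ₗ Φ) (Ψ' ∘ₗ Ψ) = tensorMap Φ' Ψ' ∘ₗ tensorMap Φ Ψ :=
  linearMap_ext_kronecker fun A B => by simp [tensorMap_kronecker]

theorem tensorMap_sum_sum {σ τ : Type} [Fintype σ] [Fintype τ] (Φ : σ → SuperOp a a')
    (Ψ : τ → SuperOp b b') :
    tensorMap (∑ s, Φ s) (∑ t, Ψ t) = ∑ p : σ × τ, tensorMap (Φ p.1) (Ψ p.2) := by
  refine linearMap_ext_kronecker fun A B => ?_
  ext ⟨x, y⟩ ⟨x', y'⟩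
  simp [tensorMap_kronecker, LinearMap.sum_apply, Matrix.sum_apply, Fintype.sum_prod_type,
    Finset.sum_mul_sum]

theorem tensorMap_add_left (Φ Φ' : SuperOp a a') (Ψ : SuperOp b b') :
    tensorMap (Φ + Φ') Ψ = tensorMap Φ Ψ + tensorMap Φ' Ψ :=
  linearMap_ext_kronecker fun A B => by simp [tensorMap_kronecker, Matrix.add_kronecker]

theorem tensorMap_smul_left (c : ℂ) (Φ : SuperOp a a') (Ψ : SuperOp b b') :
    tensorMap (c • Φ) Ψ = c • tensorMap Φ Ψ :=
  linearMap_ext_kronecker fun A B => by simp [tensorMap_kronecker, Matrix.smul_kronecker]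

end Tensor

/-! ### Kraus decompositions and complete positivity. -/

section Kraus

/-- Conjugation `X ↦ K X K†`. -/
noncomputable def conjMap {a b : Type} [Fintype a] (K : Matrix b a ℂ) : SuperOp a b where
  toFun X := K * X * K.conjTranspose
  map_add' X Y := by rw [Matrix.mul_add, Matrix.add_mul]
  map_smul' c X := by simp

/-- A map with a (finite) Kraus decomposition. -/
def HasKraus {a b : Type} [Fintype a] (Φ : SuperOp a b) : Prop :=
  ∃ (ι : Type) (_ : Fintype ι) (K : ι → Matrix b a ℂ), Φ = ∑ r, conjMap (K r)

variable {a b a' b' : Type} [Fintype a]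

@[simp] theorem conjMap_apply (K : Matrix b a ℂ) (X : Op a) :
    conjMap K X = K * X * K.conjTranspose := rfl

theorem conjMap_single_apply [DecidableEq a] (K : Matrix b a ℂ) (i j : a) (x y : b) :
    conjMap K (Matrix.single i j 1) x y = K x i * star (K y j) := by
  simp [Matrix.mul_apply, Matrix.single_apply, Finset.sum_ite_eq, ite_and]

theorem hasKraus_conjMap (K : Matrix b a ℂ) : HasKraus (conjMap K) :=
  ⟨Unit, inferInstance, fun _ => K, by simp⟩

theorem hasKraus_id [DecidableEq a] : HasKraus (LinearMap.id : SuperOp a a) := by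
  convert hasKraus_conjMap (1 : Matrix a a ℂ)
  ext1 X
  simp

theorem HasKraus.sum {σ : Type} [Fintype σ] {Φ : σ → SuperOp a b} (h : ∀ s, HasKraus (Φ s)) :
    HasKraus (∑ s, Φ s) := by
  choose ι hι K hK using h
  refine ⟨Σ s, ι s, inferInstance, fun r => K r.1 r.2, ?_⟩
  rw [Fintype.sum_sigma]
  exact Finset.sum_congr rfl fun s _ => hK s

theorem HasKraus.comp {c : Type} [Fintype b] {Φ : SuperOp a b} {Ψ : SuperOp b c} (hΨ : HasKraus Ψ)
    (hΦ : HasKraus Φ) : HasKraus (Ψ ∘ₗ Φ) := by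
  obtain ⟨ι, _, K, rfl⟩ := hΦ
  obtain ⟨κ, _, L, rfl⟩ := hΨ
  refine ⟨κ × ι, inferInstance, fun r => L r.1 * K r.2, ?_⟩
  ext1 X
  simp [LinearMap.sum_apply, Fintype.sum_prod_type, Matrix.mul_assoc]

theorem tensorMap_conjMap [Fintype b] [DecidableEq a] [DecidableEq b] (K : Matrix a' a ℂ)
    (L : Matrix b' b ℂ) :
    tensorMap (conjMap K) (conjMap L) = conjMap (K ⊗ₖ L) :=
  linearMap_ext_kronecker fun A B => by
    simp [tensorMap_kronecker, Matrix.mul_kronecker_mul, Matrix.conjTranspose_kronecker]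

theorem HasKraus.tensorMap [Fintype b] [DecidableEq a] [DecidableEq b] {Φ : SuperOp a a'}
    {Ψ : SuperOp b b'} (hΦ : HasKraus Φ) (hΨ : HasKraus Ψ) : HasKraus (tensorMap Φ Ψ) := by
  obtain ⟨ι, _, K, rfl⟩ := hΦ
  obtain ⟨κ, _, L, rfl⟩ := hΨ
  refine ⟨ι × κ, inferInstance, fun r => K r.1 ⊗ₖ L r.2, ?_⟩
  simp only [tensorMap_sum_sum, tensorMap_conjMap]

theorem HasKraus.posSemidef [Fintype b] {Φ : SuperOp a b} (hΦ : HasKraus Φ) {X : Op a}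
    (hX : X.PosSemidef) : (Φ X).PosSemidef := by
  obtain ⟨ι, _, K, rfl⟩ := hΦ
  rw [LinearMap.sum_apply]
  exact Matrix.posSemidef_sum _ fun r _ => hX.mul_mul_conjTranspose_same (K r)

theorem HasKraus.isCP [Fintype b] [DecidableEq a] {Φ : SuperOp a b} (hΦ : HasKraus Φ) : IsCP Φ :=
  fun _ _ hX => (hΦ.tensorMap hasKraus_id).posSemidef hX

open scoped MatrixOrder in
theorem Matrix.PosSemidef.exists_eq_conjTranspose_mul_self {n : Type} [Fintype n]
    {A : Op n} (hA : A.PosSemidef) : ∃ B : Op n, A = B.conjTranspose * B := by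
  classical
  exact CStarAlgebra.nonneg_iff_eq_star_mul_self.mp hA.nonneg

/-- Choi's argument: the Choi matrix is positive semidefinite, and the conjugated rows of a factor
`B` with Choi matrix `B† B` reshape into Kraus operators. -/
theorem IsCP.hasKraus [Fintype b] [DecidableEq a] {Φ : SuperOp a b} (hΦ : IsCP Φ) : HasKraus Φ := by
  classical
  let e := Fintype.equivFin a
  -- The unnormalised maximally entangled vector, with the ancilla a copy of `a` through `e`.
  let w : a × Fin (Fintype.card a) → ℂ := fun p => if e p.1 = p.2 then 1 else 0
  have hC := hΦ _ _ (Matrix.posSemidef_vecMulVec_self_star w)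
  have hent : ∀ (i j : a) (x y : b),
      tensorMap Φ (LinearMap.id : SuperOp (Fin (Fintype.card a)) (Fin (Fintype.card a)))
        (Matrix.vecMulVec w (star w)) (x, e i) (y, e j) = Φ (Matrix.single i j 1) x y := by
    intro i j x y
    simp only [tensorMap, LinearMap.coe_mk, AddHom.coe_mk, Matrix.sum_apply, Matrix.smul_apply,
      Matrix.kroneckerMap_apply, LinearMap.id_apply, Matrix.single_apply, Matrix.vecMulVec_apply,
      w, Pi.star_apply, smul_eq_mul]
    rw [Finset.sum_eq_single i, Finset.sum_eq_single j, Finset.sum_eq_single (e i),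
      Finset.sum_eq_single (e j)]
    · simp
    · intro l _ hl; simp [hl]
    · simp
    · intro l _ hl; simp [hl]
    · simp
    · intro l _ hl
      refine Finset.sum_eq_zero fun k _ => Finset.sum_eq_zero fun k' _ => ?_
      by_cases h : e l = k'
      · simp [← h, hl]
      · simp [h]
    · simp
    · intro l _ hl
      refine Finset.sum_eq_zero fun j' _ => Finset.sum_eq_zero fun k _ =>
        Finset.sum_eq_zero fun k' _ => ?_
      by_cases h : e l = k
      · simp [← h, hl]
      · simp [h]
    · simp
  obtain ⟨B, hB⟩ := hC.exists_eq_conjTranspose_mul_self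
  rw [hB] at hent
  refine ⟨_, inferInstance, fun r => Matrix.of fun x i => star (B r (x, e i)), ?_⟩
  refine Matrix.ext_linearMap ℂ fun i j => LinearMap.ext_ring ?_
  ext x y
  simp only [LinearMap.comp_apply, Matrix.singleLinearMap_apply, LinearMap.sum_apply,
    Matrix.sum_apply, conjMap_single_apply, ← hent]
  simp [Matrix.mul_apply]

end Kraus

/-! ### Closure properties and boundedness of channels. -/

section Channels

variable {a b c a' b' : Type} [Fintype a] [DecidableEq a] [Fintype b] [DecidableEq b]
  [Fintype c] [Fintype a'] [Fintype b']

theorem IsChannel.comp {Φ : SuperOp a b} {Ψ : SuperOp b c} (hΨ : IsChannel Ψ)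
    (hΦ : IsChannel Φ) : IsChannel (Ψ ∘ₗ Φ) :=
  ⟨(hΨ.1.hasKraus.comp hΦ.1.hasKraus).isCP, fun X => by
    rw [LinearMap.comp_apply, hΨ.2, hΦ.2]⟩

theorem isChannel_id : IsChannel (LinearMap.id : SuperOp a a) :=
  ⟨hasKraus_id.isCP, fun _ => rfl⟩

theorem IsChannel.tensorMap {Φ : SuperOp a a'} {Ψ : SuperOp b b'} (hΦ : IsChannel Φ)
    (hΨ : IsChannel Ψ) : IsChannel (tensorMap Φ Ψ) := by
  refine ⟨(hΦ.1.hasKraus.tensorMap hΨ.1.hasKraus).isCP, fun X => ?_⟩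
  have h : Matrix.traceLinearMap (a' × b') ℂ ℂ ∘ₗ _root_.tensorMap Φ Ψ =
      Matrix.traceLinearMap (a × b) ℂ ℂ :=
    linearMap_ext_kronecker fun A B => by
      simp [tensorMap_kronecker, Matrix.trace_kronecker, hΦ.2, hΨ.2]
  exact LinearMap.congr_fun h X

-- Trace preservation bounds each Kraus column sum of squares by 1, and `st ≤ (s² + t²)/2` handles
-- mixed entries. This uniform bound feeds the compactness argument.
omit [DecidableEq b] in
theorem IsChannel.norm_apply_single_le {Φ : SuperOp a b} (hΦ : IsChannel Φ) (i j : a) (x y : b) :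
    ‖Φ (Matrix.single i j 1) x y‖ ≤ 1 := by
  obtain ⟨ι, _, K, hK⟩ := hΦ.1.hasKraus
  have hent : ∀ (i j : a) (x y : b), Φ (Matrix.single i j 1) x y =
      ∑ r, K r x i * star (K r y j) := fun i j x y => by
    simp only [hK, LinearMap.sum_apply, Matrix.sum_apply, conjMap_single_apply]
  have hdiag : ∀ i x, ∑ r, ‖K r x i‖ ^ 2 ≤ 1 := by
    intro i x
    have h1 := hΦ.2 (Matrix.single i i 1)
    simp only [Matrix.trace, Matrix.diag, hent, Matrix.single_apply, Finset.sum_ite_eq,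
      and_self, Finset.mem_univ, if_true] at h1
    have h2 : ∑ z, ∑ r, ‖K r z i‖ ^ 2 = 1 := by
      apply Complex.ofReal_injective
      push_cast
      rw [← h1]
      refine Finset.sum_congr rfl fun z _ => Finset.sum_congr rfl fun r _ => ?_
      exact (Complex.mul_conj' _).symm
    rw [← h2]
    exact Finset.single_le_sum (f := fun z => ∑ r, ‖K r z i‖ ^ 2)
      (fun z _ => Finset.sum_nonneg fun r _ => sq_nonneg _) (Finset.mem_univ x)
  calc ‖Φ (Matrix.single i j 1) x y‖ ≤ ∑ r, ‖K r x i * star (K r y j)‖ := by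
        rw [hent]; exact norm_sum_le _ _
    _ ≤ ∑ r, (‖K r x i‖ ^ 2 + ‖K r y j‖ ^ 2) / 2 := Finset.sum_le_sum fun r _ => by
        rw [norm_mul, norm_star]
        nlinarith [sq_nonneg (‖K r x i‖ - ‖K r y j‖)]
    _ ≤ 1 := by
        rw [← Finset.sum_div, Finset.sum_add_distrib]
        linarith [hdiag i x, hdiag j y]

end Channels

/-! ### Classical (stochastic) maps between incoherent bases. -/

section Classical

/-- The measure-and-prepare map in the incoherent bases with transition matrix `P`. -/
noncomputable def classicalMap {a b : Type} [Fintype a] [DecidableEq b] (P : Matrix b a ℂ) :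
    SuperOp a b where
  toFun X := Matrix.diagonal fun y => ∑ x, P y x * X x x
  map_add' X Y := by
    rw [Matrix.diagonal_add]
    congr 1
    ext y
    simp [mul_add, Finset.sum_add_distrib]
  map_smul' c X := by
    rw [RingHom.id_apply, ← Matrix.diagonal_smul]
    congr 1
    ext y
    simp [Finset.mul_sum, mul_left_comm]

variable {a b c a' b' : Type} [Fintype a] [DecidableEq b]

theorem classicalMap_apply (P : Matrix b a ℂ) (X : Op a) :
    classicalMap P X = Matrix.diagonal fun y => ∑ x, P y x * X x x := rfl

omit [Fintype a] in
theorem dephasing_apply [DecidableEq a] (X : Op a) :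
    dephasing a X = Matrix.diagonal fun i => X i i := rfl

theorem dephasing_eq_classicalMap [DecidableEq a] : dephasing a = classicalMap 1 := by
  ext1 X
  rw [classicalMap_apply, dephasing_apply]
  congr 1
  ext y
  simp [Matrix.one_apply]

theorem classicalMap_comp [Fintype b] [DecidableEq c] (Q : Matrix c b ℂ) (P : Matrix b a ℂ) :
    classicalMap Q ∘ₗ classicalMap P = classicalMap (Q * P) := by
  ext1 X
  rw [LinearMap.comp_apply, classicalMap_apply, classicalMap_apply, classicalMap_apply]
  congr 1
  ext z
  simp only [Matrix.diagonal_apply_eq, Matrix.mul_apply, Finset.mul_sum, Finset.sum_mul]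
  rw [Finset.sum_comm]
  simp only [mul_assoc]

theorem classicalMap_sum {σ : Type} [Fintype σ] (P : σ → Matrix b a ℂ) :
    ∑ s, classicalMap (P s) = classicalMap (∑ s, P s) := by
  ext1 X
  ext y y'
  by_cases h : y = y'
  · subst h
    simp only [LinearMap.sum_apply, Matrix.sum_apply, classicalMap_apply,
      Matrix.diagonal_apply_eq, Finset.sum_mul]
    rw [Finset.sum_comm]
  · simp [LinearMap.sum_apply, Matrix.sum_apply, classicalMap_apply, h]

theorem tensorMap_classicalMap [DecidableEq a] [Fintype c] [DecidableEq c] [DecidableEq b']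
    (P : Matrix b a ℂ) (Q : Matrix b' c ℂ) :
    tensorMap (classicalMap P) (classicalMap Q) = classicalMap (P ⊗ₖ Q) := by
  refine linearMap_ext_kronecker fun A B => ?_
  rw [tensorMap_kronecker, classicalMap_apply, classicalMap_apply, classicalMap_apply,
    Matrix.diagonal_kronecker_diagonal]
  congr 1
  ext ⟨y, z⟩
  simp only [Matrix.kroneckerMap_apply, Fintype.sum_prod_type, Finset.sum_mul_sum]
  refine Finset.sum_congr rfl fun i _ => Finset.sum_congr rfl fun j _ => ?_
  ring

theorem isCP_classicalMap [DecidableEq a] [Fintype b] {P : Matrix b a ℂ}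
    (hP : ∀ y x, 0 ≤ P y x) : IsCP (classicalMap P) := by
  refine HasKraus.isCP ⟨b × a, inferInstance,
    fun r => Matrix.single r.1 r.2 (Real.sqrt (P r.1 r.2).re : ℂ), ?_⟩
  have hs : ∀ y x, (Real.sqrt (P y x).re : ℂ) * (Real.sqrt (P y x).re : ℂ) = P y x := by
    intro y x
    rw [← Complex.ofReal_mul, Real.mul_self_sqrt (Complex.nonneg_iff.mp (hP y x)).1]
    exact (Complex.eq_re_of_ofReal_le (r := 0) (by simpa using hP y x)).symm
  ext1 X
  ext y y'
  rw [classicalMap_apply, LinearMap.sum_apply, Matrix.sum_apply, Fintype.sum_prod_type]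
  have hterm : ∀ z x, conjMap (Matrix.single z x (Real.sqrt (P z x).re : ℂ)) X y y' =
      if z = y ∧ z = y' then P z x * X x x else 0 := by
    intro z x
    rw [conjMap_apply, Matrix.conjTranspose_single, Matrix.single_mul_mul_single,
      Matrix.single_apply, RCLike.star_def, Complex.conj_ofReal, mul_right_comm, hs z x]
  simp only [hterm]
  by_cases h : y = y'
  · subst h
    rw [Matrix.diagonal_apply_eq, Finset.sum_eq_single y]
    · simp
    · intro z _ hz; simp [hz]
    · simp
  · rw [Matrix.diagonal_apply_ne _ h]
    refine (Finset.sum_eq_zero fun z _ => Finset.sum_eq_zero fun x _ => if_neg ?_).symm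
    rintro ⟨rfl, h'⟩
    exact h h'

theorem isChannel_classicalMap [DecidableEq a] [Fintype b] {P : Matrix b a ℂ}
    (hP : ∀ y x, 0 ≤ P y x) (hP1 : ∀ x, ∑ y, P y x = 1) : IsChannel (classicalMap P) := by
  refine ⟨isCP_classicalMap hP, fun X => ?_⟩
  rw [classicalMap_apply, Matrix.trace_diagonal, Finset.sum_comm]
  simp [← Finset.sum_mul, hP1, Matrix.trace]

theorem isChannel_dephasing [DecidableEq a] : IsChannel (dephasing a) := by
  rw [dephasing_eq_classicalMap]
  refine isChannel_classicalMap (fun y x => ?_) fun x => by simp [Matrix.one_apply]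
  rw [Matrix.one_apply]
  split_ifs <;> simp

theorem dephasing_comp_dephasing [DecidableEq a] :
    dephasing a ∘ₗ dephasing a = dephasing a := by
  rw [dephasing_eq_classicalMap, classicalMap_comp, mul_one]

theorem tensorMap_dephasing [DecidableEq a] [Fintype b] :
    tensorMap (dephasing a) (dephasing b) = dephasing (a × b) := by
  simp only [dephasing_eq_classicalMap, tensorMap_classicalMap, Matrix.one_kronecker_one]

theorem dephasing_comp_comp_dephasing [DecidableEq a] [Fintype b] (Φ : SuperOp a b) :
    dephasing b ∘ₗ Φ ∘ₗ dephasing a =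
      classicalMap (Matrix.of fun y x => Φ (Matrix.single x x 1) y y) := by
  ext1 X
  rw [LinearMap.comp_apply, LinearMap.comp_apply, dephasing_apply, dephasing_apply,
    classicalMap_apply]
  congr 1
  ext y
  rw [← Matrix.sum_single_eq_diagonal, map_sum, Matrix.sum_apply]
  refine Finset.sum_congr rfl fun x _ => ?_
  have : Matrix.single x x (X x x) = X x x • Matrix.single x x (1 : ℂ) := by
    rw [Matrix.smul_single, smul_eq_mul, mul_one]
  rw [this, map_smul, Matrix.smul_apply, smul_eq_mul, mul_comm, Matrix.of_apply]

end Classical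

/-! ### Detection-incoherent and unital operations. -/

section DetectionIncoherent

variable {a b : Type} [Fintype a] [DecidableEq a] [Fintype b] [DecidableEq b]

theorem isDIO_id : IsDIO (LinearMap.id : SuperOp a a) :=
  ⟨isChannel_id, by simp [dephasing_comp_dephasing]⟩

theorem IsDIO.comp {Φ Ψ : SuperOp a a} (hΨ : IsDIO Ψ) (hΦ : IsDIO Φ) : IsDIO (Ψ ∘ₗ Φ) := by
  refine ⟨hΨ.1.comp hΦ.1, ?_⟩
  ext1 X
  have hΨ' := fun Y => LinearMap.congr_fun hΨ.2 Y
  have hΦ' := fun Y => LinearMap.congr_fun hΦ.2 Y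
  simp only [LinearMap.comp_apply] at hΨ' hΦ' ⊢
  -- `ΔΨΦ = ΔΨΔΦ = ΔΨΔΦΔ = ΔΨΦΔ`.
  rw [hΨ' (Φ X), hΦ' X, ← hΨ']

theorem IsDIO.tensorMap_id {Φ : SuperOp a a} (hΦ : IsDIO Φ) :
    IsDIO (tensorMap Φ (LinearMap.id : SuperOp b b)) := by
  refine ⟨hΦ.1.tensorMap isChannel_id, ?_⟩
  rw [← tensorMap_dephasing, ← tensorMap_comp, ← tensorMap_comp, ← tensorMap_comp, hΦ.2]
  simp [dephasing_comp_dephasing]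

omit [Fintype a] in
theorem IsUnital.comp {Φ Ψ : SuperOp a a} (hΨ : IsUnital Ψ) (hΦ : IsUnital Φ) :
    IsUnital (Ψ ∘ₗ Φ) := by
  rw [IsUnital, LinearMap.comp_apply, hΦ, hΨ]

theorem IsUnital.tensorMap_id {Φ : SuperOp a a} (hΦ : IsUnital Φ) :
    IsUnital (tensorMap Φ (LinearMap.id : SuperOp b b)) := by
  rw [IsUnital, ← Matrix.one_kronecker_one, tensorMap_kronecker, hΦ, LinearMap.id_apply]

/-- A channel that never detects the off-diagonal matrix units is detection-incoherent. -/
theorem isDIO_of_apply_single_eq_zero {Φ : SuperOp a a} (hΦ : IsChannel Φ)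
    (h : ∀ i j k, i ≠ j → Φ (Matrix.single i j 1) k k = 0) : IsDIO Φ := by
  refine ⟨hΦ, Matrix.ext_linearMap ℂ fun i j => LinearMap.ext_ring ?_⟩
  simp only [LinearMap.comp_apply, Matrix.singleLinearMap_apply]
  by_cases hij : i = j
  · subst hij
    congr 2
    rw [dephasing_apply]
    ext x y
    simp only [Matrix.single_apply, Matrix.diagonal_apply]
    grind
  · have h0 : dephasing a (Matrix.single i j (1 : ℂ)) = 0 := by
      rw [dephasing_apply, ← Matrix.diagonal_zero]
      congr 1
      ext x
      rw [Matrix.single_apply, if_neg]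
      rintro ⟨rfl, rfl⟩
      exact hij rfl
    rw [h0, map_zero, map_zero, dephasing_apply, ← Matrix.diagonal_zero]
    congr 1
    ext k
    exact h i j k hij

theorem conjMap_perm_apply (e : Equiv.Perm a) (X : Op a) :
    conjMap (e.toPEquiv.toMatrix : Matrix a a ℂ) X = X.submatrix e e := by
  ext x y
  simp [PEquiv.toMatrix_toPEquiv_mul, Matrix.mul_apply, Equiv.symm_apply_eq]

theorem isDIO_conjMap_perm (e : Equiv.Perm a) :
    IsDIO (conjMap (e.toPEquiv.toMatrix : Matrix a a ℂ)) := by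
  refine ⟨⟨(hasKraus_conjMap _).isCP, fun X => ?_⟩, ?_⟩
  · rw [conjMap_perm_apply, Matrix.trace, Matrix.trace]
    exact Equiv.sum_comp e fun i => X i i
  · ext1 X
    simp only [LinearMap.comp_apply, conjMap_perm_apply, dephasing_apply]
    simp

theorem isUnital_conjMap_perm (e : Equiv.Perm a) :
    IsUnital (conjMap (e.toPEquiv.toMatrix : Matrix a a ℂ)) := by
  rw [IsUnital, conjMap_perm_apply, Matrix.submatrix_one_equiv]

end DetectionIncoherent

/-! ### Dephased DIO are LOCC. -/

section LOCC

variable {a b a' b' : Type} [Fintype a] [DecidableEq a] [Fintype b] [DecidableEq b]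
  [Fintype a'] [DecidableEq a'] [Fintype b'] [DecidableEq b']

theorem IsLOCC.isClosedLOCC {Ξ : SuperOp (a × b) (a × b)} (h : IsLOCC Ξ) : IsClosedLOCC Ξ :=
  ⟨fun _ => Ξ, fun _ => h, fun _ => tendsto_const_nhds⟩

/-- Classical processing of the outcomes of local incoherent measurements is LOCC: the first party
sends its outcome to the second one, who samples both outputs and sends one of them back. -/
theorem isLOCC_classicalMap {P : Matrix (a' × b') (a × b) ℂ} (hP : ∀ y x, 0 ≤ P y x)
    (hP1 : ∀ x, ∑ y, P y x = 1) : IsLOCC (classicalMap P) := by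
  -- `A x` records outcome `x` and leaves the first party a trivial system; `B x` samples the whole
  -- output pair on the second side. Then `G k` reports the first component `k` and keeps the
  -- second, and `F k` prepares `k`.
  let A : a → Matrix Unit a ℂ := fun x => Matrix.of fun _ i => if i = x then 1 else 0
  let B : a → Matrix (a' × b') b ℂ := fun x => Matrix.of fun y j => P y (x, j)
  let F : a' → Matrix a' Unit ℂ := fun k => Matrix.of fun k' _ => if k' = k then 1 else 0
  let G : a' → Matrix b' (a' × b') ℂ :=
    fun k => Matrix.of fun l y => if y = (k, l) then 1 else 0
  have hA : ∀ x y i, 0 ≤ A x y i := fun x y i => by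
    simp only [A, Matrix.of_apply]; split_ifs <;> simp
  have hF : ∀ k y i, 0 ≤ F k y i := fun k y i => by
    simp only [F, Matrix.of_apply]; split_ifs <;> simp
  have hG : ∀ k l y, 0 ≤ G k l y := fun k l y => by
    simp only [G, Matrix.of_apply]; split_ifs <;> simp
  have hA1 : IsChannel (∑ x, classicalMap (A x)) := by
    rw [classicalMap_sum]
    refine isChannel_classicalMap (fun y i => ?_) fun i => ?_
    · rw [Matrix.sum_apply]
      exact Finset.sum_nonneg fun x _ => hA x y i
    · simp [A, Matrix.sum_apply]
  have hB1 : ∀ x, IsChannel (classicalMap (B x)) := fun x =>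
    isChannel_classicalMap (fun y j => hP y (x, j)) fun j => hP1 (x, j)
  have hF1 : ∀ k, IsChannel (classicalMap (F k)) := fun k =>
    isChannel_classicalMap (hF k) fun j => by simp [F]
  have hG1 : IsChannel (∑ k, classicalMap (G k)) := by
    rw [classicalMap_sum]
    refine isChannel_classicalMap (fun l y => ?_) fun y => ?_
    · rw [Matrix.sum_apply]
      exact Finset.sum_nonneg fun k _ => hG k l y
    · simp only [G, Matrix.sum_apply, Matrix.of_apply]
      rw [Finset.sum_comm,
        ← Fintype.sum_prod_type' (f := fun k l => if y = (k, l) then (1 : ℂ) else 0)]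
      simp
  have h1 : IsLOCC (∑ x, tensorMap (classicalMap (A x)) (classicalMap (B x))) :=
    IsLOCC.right _ ⟨a, inferInstance, fun x => classicalMap (A x), fun x => classicalMap (B x),
      fun x => isCP_classicalMap (hA x), hA1, hB1, rfl⟩
  have h2 : IsLOCC (∑ k, tensorMap (classicalMap (F k)) (classicalMap (G k))) :=
    IsLOCC.left _ ⟨a', inferInstance, fun k => classicalMap (F k), fun k => classicalMap (G k),
      hF1, fun k => isCP_classicalMap (hG k), hG1, rfl⟩
  convert IsLOCC.comp _ _ h1 h2
  simp only [tensorMap_classicalMap, classicalMap_sum, classicalMap_comp]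
  congr 1
  ext ⟨k, l⟩ ⟨i, j⟩
  simp [A, B, F, G, Matrix.mul_apply, Matrix.sum_apply, Fintype.sum_prod_type, ite_and]

theorem IsDIO.isLOCC_dephasing_comp {Ξ : SuperOp (a × b) (a × b)} (h : IsDIO Ξ) :
    IsLOCC (dephasing (a × b) ∘ₗ Ξ) := by
  rw [h.2, dephasing_comp_comp_dephasing]
  refine isLOCC_classicalMap (fun y x => ?_) fun x => ?_
  · have hps : (Matrix.single x x (1 : ℂ)).PosSemidef := by
      rw [← Matrix.diagonal_single]
      exact Matrix.PosSemidef.diagonal (Pi.single_nonneg.mpr zero_le_one)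
    exact (h.1.1.hasKraus.posSemidef hps).diag_nonneg
  · have := h.1.2 (Matrix.single x x 1)
    rw [Matrix.trace_single_eq_same] at this
    exact this

end LOCC

/-! ### Block positivity, an invariant of LOCC. -/

section BlockPositive

variable {a b a' b' : Type}

/-- The product vector `u ⊗ v`. -/
def prodVec (u : a → ℂ) (v : b → ℂ) : a × b → ℂ := fun p => u p.1 * v p.2

/-- Nonnegativity of the quadratic form of a bipartite operator on product vectors. -/
def IsBlockPositive [Fintype a] [Fintype b] (X : Op (a × b)) : Prop :=
  ∀ (u : a → ℂ) (v : b → ℂ), 0 ≤ star (prodVec u v) ⬝ᵥ (X.mulVec (prodVec u v))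

variable [Fintype a] [Fintype b]

theorem IsBlockPositive.sum {σ : Type} [Fintype σ] {X : σ → Op (a × b)}
    (h : ∀ s, IsBlockPositive (X s)) : IsBlockPositive (∑ s, X s) := fun u v => by
  rw [Matrix.sum_mulVec, dotProduct_sum]
  exact Finset.sum_nonneg fun s _ => h s u v

theorem IsBlockPositive.diag_nonneg {X : Op (a × b)} (h : IsBlockPositive X) (p : a × b) :
    0 ≤ X p p := by
  classical
  have hp : prodVec (Pi.single p.1 1) (Pi.single p.2 1) = (Pi.single p 1 : a × b → ℂ) := by
    ext q
    simp only [prodVec, Pi.single_apply, Prod.ext_iff]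
    grind
  have := h (Pi.single p.1 1) (Pi.single p.2 1)
  rw [hp] at this
  simpa using this

theorem kronecker_mulVec_prodVec (K : Matrix a' a ℂ) (L : Matrix b' b ℂ) (u : a → ℂ) (v : b → ℂ) :
    (K ⊗ₖ L).mulVec (prodVec u v) = prodVec (K.mulVec u) (L.mulVec v) := by
  ext ⟨x, y⟩
  simp only [Matrix.mulVec, dotProduct, prodVec, Matrix.kroneckerMap_apply, Fintype.sum_prod_type,
    Finset.sum_mul_sum]
  refine Finset.sum_congr rfl fun i _ => Finset.sum_congr rfl fun j _ => ?_
  ring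

variable [Fintype a'] [Fintype b']

/-- The adjoint of `K ⊗ L` sends product vectors to product vectors. -/
theorem IsBlockPositive.conjMap_kronecker {X : Op (a × b)} (h : IsBlockPositive X)
    (K : Matrix a' a ℂ) (L : Matrix b' b ℂ) : IsBlockPositive (conjMap (K ⊗ₖ L) X) := by
  intro u v
  have := h (K.conjTranspose.mulVec u) (L.conjTranspose.mulVec v)
  rw [← kronecker_mulVec_prodVec, ← Matrix.conjTranspose_kronecker, Matrix.star_mulVec,
    Matrix.conjTranspose_conjTranspose, ← Matrix.dotProduct_mulVec, Matrix.mulVec_mulVec,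
    Matrix.mulVec_mulVec] at this
  exact this

variable [DecidableEq a] [DecidableEq b]

theorem IsBlockPositive.tensorMap {X : Op (a × b)} (h : IsBlockPositive X) {Φ : SuperOp a a'}
    {Ψ : SuperOp b b'} (hΦ : IsCP Φ) (hΨ : IsCP Ψ) : IsBlockPositive (tensorMap Φ Ψ X) := by
  obtain ⟨ι, _, K, rfl⟩ := hΦ.hasKraus
  obtain ⟨κ, _, L, rfl⟩ := hΨ.hasKraus
  simp only [tensorMap_sum_sum, tensorMap_conjMap, LinearMap.sum_apply]
  exact .sum fun r => h.conjMap_kronecker _ _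

theorem IsLOCC.isBlockPositive [DecidableEq a'] [DecidableEq b']
    {Ξ : SuperOp (a × b) (a' × b')} (hΞ : IsLOCC Ξ) :
    ∀ X, IsBlockPositive X → IsBlockPositive (Ξ X) := by
  induction hΞ with
  | right Ξ h =>
    obtain ⟨σ, _, Φ, Ψ, hΦ, -, hΨ, rfl⟩ := h
    intro X hX
    rw [LinearMap.sum_apply]
    exact .sum fun s => hX.tensorMap (hΦ s) (hΨ s).1
  | left Ξ h =>
    obtain ⟨σ, _, Φ, Ψ, hΦ, hΨ, -, rfl⟩ := h
    intro X hX
    rw [LinearMap.sum_apply]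
    exact .sum fun s => hX.tensorMap (hΦ s).1 (hΨ s)
  | comp Ξ Ξ' _ _ ih ih' => exact fun X hX => ih' _ (ih X hX)

/-- Basis vectors are product vectors, and nonnegativity of an entry survives limits. -/
theorem IsClosedLOCC.diag_nonneg {Ξ : SuperOp (a × b) (a × b)} (hΞ : IsClosedLOCC Ξ)
    {X : Op (a × b)} (hX : IsBlockPositive X) (p : a × b) : 0 ≤ Ξ X p p := by
  obtain ⟨Ξs, hs, hlim⟩ := hΞ
  have h := ((continuous_apply_apply p p).tendsto (Ξ X)).comp (hlim X)
  exact ge_of_tendsto' h fun n => ((hs n).isBlockPositive X hX).diag_nonneg p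

/-- The entanglement witness supported on the basis vectors `i` and `j` of both parties. -/
noncomputable def flipWitness (i j : a) (β : ℂ) : Op (a × a) :=
  Matrix.single (i, j) (i, j) 1 + Matrix.single (j, i) (j, i) (β * star β) +
    Matrix.single (i, i) (j, j) (star β) + Matrix.single (j, j) (i, i) β

/-- The witness is the partial transpose of `|ψ⟩⟨ψ|` with `ψ = |ij⟩ + β|ji⟩`, so on product vectors
its form is a squared modulus. -/
theorem isBlockPositive_flipWitness (i j : a) (β : ℂ) : IsBlockPositive (flipWitness i j β) := by
  intro u v
  have h : star (prodVec u v) ⬝ᵥ ((flipWitness i j β).mulVec (prodVec u v)) =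
      star (star (u i * star (v j)) + star (star β * u j * star (v i))) *
        (star (u i * star (v j)) + star (star β * u j * star (v i))) := by
    simp only [flipWitness, Matrix.add_mulVec, Matrix.single_mulVec_eq, dotProduct_add]
    simp [prodVec]
    ring
  rw [h]
  exact star_mul_self_nonneg _

end BlockPositive

/-! ### Limits and compactness of channels. -/

section Limits

open Filter Topology

variable {a b c : Type}

theorem MapsTendTo.subseq {Φs : ℕ → SuperOp a b} {Φ : SuperOp a b} (h : MapsTendTo Φs Φ)
    {φ : ℕ → ℕ} (hφ : StrictMono φ) : MapsTendTo (Φs ∘ φ) Φ :=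
  fun X => (h X).comp hφ.tendsto_atTop

theorem mapsTendTo_const (Φ : SuperOp a b) : MapsTendTo (fun _ => Φ) Φ :=
  fun _ => tendsto_const_nhds

/-- Expanding the inner output in finitely many matrix units reduces joint convergence to that of
scalars and of fixed-input values. -/
theorem MapsTendTo.comp [Fintype b] [DecidableEq b] {Φs : ℕ → SuperOp a b} {Φ : SuperOp a b}
    {Ψs : ℕ → SuperOp b c} {Ψ : SuperOp b c} (hΨ : MapsTendTo Ψs Ψ) (hΦ : MapsTendTo Φs Φ) :
    MapsTendTo (fun n => Ψs n ∘ₗ Φs n) (Ψ ∘ₗ Φ) := by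
  intro X
  have h : ∀ (Θ : SuperOp b c) (Λ : SuperOp a b), (Θ ∘ₗ Λ) X =
      ∑ i, ∑ j, Λ X i j • Θ (Matrix.single i j 1) :=
    fun Θ Λ => superOp_apply_eq_sum Θ (Λ X)
  simp only [h]
  refine tendsto_finsetSum _ fun i _ => tendsto_finsetSum _ fun j _ => Tendsto.smul ?_ (hΨ _)
  exact ((continuous_apply_apply i j).tendsto (Φ X)).comp (hΦ X)

theorem mapsTendTo_unique {Φs : ℕ → SuperOp a b} {Φ Ψ : SuperOp a b} (hΦ : MapsTendTo Φs Φ)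
    (hΨ : MapsTendTo Φs Ψ) : Φ = Ψ :=
  LinearMap.ext fun X => tendsto_nhds_unique (hΦ X) (hΨ X)

variable [Fintype a] [DecidableEq a]

theorem Matrix.PosSemidef.of_tendsto [Fintype b] {Xs : ℕ → Op b} {X : Op b}
    (h : ∀ n, (Xs n).PosSemidef) (hX : Tendsto Xs atTop (𝓝 X)) : X.PosSemidef := by
  refine .of_dotProduct_mulVec_nonneg ?_ fun v => ?_
  · have h1 : Tendsto (fun n => (Xs n).conjTranspose) atTop (𝓝 X.conjTranspose) :=
      ((continuous_id.matrix_conjTranspose).tendsto X).comp hX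
    exact tendsto_nhds_unique (h1.congr fun n => (h n).isHermitian) hX
  · have hc : Continuous fun Y : Op b => star v ⬝ᵥ Y.mulVec v :=
      continuous_const.dotProduct (continuous_id.matrix_mulVec continuous_const)
    exact ge_of_tendsto' ((hc.tendsto X).comp hX) fun n => (h n).dotProduct_mulVec_nonneg v

theorem IsChannel.of_mapsTendTo [Fintype b] {Φs : ℕ → SuperOp a b} {Φ : SuperOp a b}
    (h : ∀ n, IsChannel (Φs n)) (hΦ : MapsTendTo Φs Φ) : IsChannel Φ := by
  refine ⟨fun k X hX => .of_tendsto (fun n => (h n).1 k X hX) ?_, fun X => ?_⟩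
  · refine tendsto_finsetSum _ fun i _ => tendsto_finsetSum _ fun j _ =>
      tendsto_finsetSum _ fun k _ => tendsto_finsetSum _ fun l _ => Tendsto.const_smul ?_ _
    refine tendsto_pi_nhds.mpr fun p => tendsto_pi_nhds.mpr fun q => ?_
    exact (((continuous_apply_apply p.1 q.1).tendsto _).comp (hΦ _)).mul tendsto_const_nhds
  · have h1 : Tendsto (fun n => (Φs n X).trace) atTop (𝓝 (Φ X).trace) :=
      ((continuous_id.matrix_trace).tendsto _).comp (hΦ X)
    exact tendsto_nhds_unique h1 (tendsto_const_nhds.congr fun n => ((h n).2 X).symm)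

theorem IsDIO.of_mapsTendTo {Φs : ℕ → SuperOp a a} {Φ : SuperOp a a}
    (h : ∀ n, IsDIO (Φs n)) (hΦ : MapsTendTo Φs Φ) : IsDIO Φ := by
  refine ⟨.of_mapsTendTo (fun n => (h n).1) hΦ, ?_⟩
  refine mapsTendTo_unique ((mapsTendTo_const (dephasing a)).comp hΦ) ?_
  simp only [(h _).2]
  exact (mapsTendTo_const _).comp (hΦ.comp (mapsTendTo_const _))

omit [Fintype a] in
theorem IsUnital.of_mapsTendTo {Φs : ℕ → SuperOp a a} {Φ : SuperOp a a}
    (h : ∀ n, IsUnital (Φs n)) (hΦ : MapsTendTo Φs Φ) : IsUnital Φ :=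
  tendsto_nhds_unique (hΦ 1) (tendsto_const_nhds.congr fun n => (h n).symm)

/-- Sequential compactness of the set of channels. -/
theorem exists_subseq_mapsTendTo [Fintype b] {Φs : ℕ → SuperOp a b}
    (h : ∀ n, IsChannel (Φs n)) :
    ∃ (Φ : SuperOp a b) (φ : ℕ → ℕ), StrictMono φ ∧ MapsTendTo (Φs ∘ φ) Φ := by
  let f : ℕ → a × a → b × b → ℂ := fun n p q => Φs n (Matrix.single p.1 p.2 1) q.1 q.2
  have hK : IsCompact (Set.univ.pi fun _ : a × a => Set.univ.pi fun _ : b × b =>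
      Metric.closedBall (0 : ℂ) 1) :=
    isCompact_univ_pi fun _ => isCompact_univ_pi fun _ => isCompact_closedBall 0 1
  obtain ⟨g, -, φ, hφ, hg⟩ := hK.tendsto_subseq (x := f) fun n p _ q _ => by
    simpa using (h n).norm_apply_single_le p.1 p.2 q.1 q.2
  refine ⟨∑ i, ∑ j, (Matrix.entryLinearMap ℂ ℂ i j).smulRight
    (Matrix.of fun x y => g (i, j) (x, y)), φ, hφ, fun X => ?_⟩
  simp only [Function.comp_apply, superOp_apply_eq_sum (Φs _) X, LinearMap.sum_apply,
    LinearMap.smulRight_apply, Matrix.entryLinearMap_apply]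
  refine tendsto_finsetSum _ fun i _ => tendsto_finsetSum _ fun j _ => Tendsto.const_smul ?_ _
  refine tendsto_pi_nhds.mpr fun x => tendsto_pi_nhds.mpr fun y => ?_
  exact tendsto_pi_nhds.mp (tendsto_pi_nhds.mp hg (i, j)) (x, y)

end Limits

/-! ### Recovering DIO from LOCC measurements. -/

section Detection

variable {a : Type} [Fintype a] [DecidableEq a]

/-- The controlled swap of `i` and `j`, with control value `j`. -/
def controlledSwap (i j : a) : Equiv.Perm (a × a) :=
  Equiv.prodShear (Equiv.refl a) fun x => if x = j then Equiv.swap i j else Equiv.refl a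

/-- The swap disentangles the off-diagonal terms: both acquire the factor `|i⟩⟨i|` on the second
party, while the diagonal terms carry `|j⟩⟨j|`. -/
theorem conjMap_controlledSwap_flipWitness {i j : a} (hij : i ≠ j) (β : ℂ) :
    conjMap ((controlledSwap i j).symm.toPEquiv.toMatrix : Matrix (a × a) (a × a) ℂ)
      (flipWitness i j β) =
      Matrix.single i i 1 ⊗ₖ Matrix.single j j 1 +
        Matrix.single j j (β * star β) ⊗ₖ Matrix.single j j 1 +
        Matrix.single i j (star β) ⊗ₖ Matrix.single i i 1 +
        Matrix.single j i β ⊗ₖ Matrix.single i i 1 := by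
  rw [conjMap_perm_apply]
  simp only [flipWitness, Matrix.submatrix_add, Matrix.submatrix_single_equiv, Pi.add_apply,
    ← single_pair_eq_kronecker, Equiv.symm_symm]
  simp [controlledSwap, hij]

/-- If permuting the incoherent basis before measuring `Φ ⊗ id` always gives a measurement in the
closure of LOCC, then `Φ` is detection-incoherent. -/
theorem isDIO_of_isClosedLOCC {Φ : SuperOp a a} (hΦ : IsChannel Φ)
    (h : ∀ e : Equiv.Perm (a × a), IsClosedLOCC (dephasing (a × a) ∘ₗ
      tensorMap Φ (LinearMap.id : SuperOp a a) ∘ₗ conjMap (e.toPEquiv.toMatrix))) : IsDIO Φ := by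
  refine isDIO_of_apply_single_eq_zero hΦ fun i j k hij => ?_
  have key : ∀ β : ℂ, 0 ≤ star β * Φ (Matrix.single i j 1) k k +
      β * Φ (Matrix.single j i 1) k k := by
    intro β
    -- The second index `i` of the entry `(k, i)` discards the two diagonal terms.
    have := (h (controlledSwap i j).symm).diag_nonneg (isBlockPositive_flipWitness i j β) (k, i)
    rw [LinearMap.comp_apply, LinearMap.comp_apply, conjMap_controlledSwap_flipWitness hij,
      dephasing_apply, Matrix.diagonal_apply_eq] at this
    have hs : ∀ (x y : a) (t : ℂ), Φ (Matrix.single x y t) k k =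
        t * Φ (Matrix.single x y 1) k k := fun x y t => by
      rw [← smul_eq_mul, ← Matrix.smul_apply, ← map_smul, Matrix.smul_single, smul_eq_mul, mul_one]
    simp only [map_add, tensorMap_kronecker, Matrix.add_apply, Matrix.kroneckerMap_apply,
      LinearMap.id_apply, Matrix.single_apply_same, hs i j (star β), hs j i β] at this
    simpa [hij.symm] using this
  -- With `m`, `m'` the two entries, `β = ±1` gives `m + m' = 0` and `β = ±I` gives `m = m'`.
  have h1 := key 1
  have h2 := key (-1)
  have h3 := key Complex.I
  have h4 := key (-Complex.I)
  generalize Φ (Matrix.single i j 1) k k = m at *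
  generalize Φ (Matrix.single j i 1) k k = m' at *
  rw [Complex.nonneg_iff] at h1 h2 h3 h4
  simp at h1 h2 h3 h4
  apply Complex.ext <;> simp <;> linarith [h1.1, h1.2, h2.1, h2.2, h3.1, h3.2, h4.1, h4.2]

end Detection

/-! ### Properties of the induced power. -/

section InducedPower

variable {d : ℕ} {E : SuperOp (Fin d × Fin d) (Fin d × Fin d) → EReal}

theorem isChannel_dephasing_comp_tensorMap {a : Type} [Fintype a] [DecidableEq a]
    {Φ : SuperOp a a} (hΦ : IsChannel Φ) {K L : SuperOp (a × a) (a × a)} (hK : IsDIO K)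
    (hL : IsDIO L) : IsChannel (dephasing (a × a) ∘ₗ K ∘ₗ
      tensorMap Φ (LinearMap.id : SuperOp a a) ∘ₗ L) :=
  isChannel_dephasing.comp (hK.1.comp ((hΦ.tensorMap isChannel_id).comp hL.1))

theorem inducedValues_nonempty (Φ : SuperOp (Fin d) (Fin d)) : (inducedValues d E Φ).Nonempty :=
  ⟨_, LinearMap.id, LinearMap.id, isDIO_id, isDIO_id, rfl, rfl⟩

theorem tensorMap_comp_id {a b : Type} [Fintype a] [DecidableEq a] [Fintype b] [DecidableEq b]
    (Φ Ψ : SuperOp a a) : tensorMap (Ψ ∘ₗ Φ) (LinearMap.id : SuperOp b b) =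
      tensorMap Ψ LinearMap.id ∘ₗ tensorMap Φ LinearMap.id := by
  rw [← tensorMap_comp, LinearMap.comp_id]

theorem inducedValues_comp_subset (Φ : SuperOp (Fin d) (Fin d)) {K L : SuperOp (Fin d) (Fin d)}
    (hK : IsDIO K) (hL : IsDIO L) (hL1 : IsUnital L) :
    inducedValues d E (K ∘ₗ Φ ∘ₗ L) ⊆ inducedValues d E Φ := by
  rintro _ ⟨K', L', hK', hL', hL1', rfl⟩
  refine ⟨K' ∘ₗ tensorMap K LinearMap.id, tensorMap L LinearMap.id ∘ₗ L',
    hK'.comp hK.tensorMap_id, hL.tensorMap_id.comp hL', hL1.tensorMap_id.comp hL1', ?_⟩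
  rw [tensorMap_comp_id, tensorMap_comp_id, LinearMap.comp_assoc, LinearMap.comp_assoc,
    LinearMap.comp_assoc]

theorem inducedPower_nonneg (hE : IsMeasEntanglingMonotone d E) {Φ : SuperOp (Fin d) (Fin d)}
    (hΦ : IsChannel Φ) : 0 ≤ inducedPower d E Φ := by
  obtain ⟨v, hv⟩ := inducedValues_nonempty (E := E) Φ
  refine le_trans ?_ (le_sSup hv)
  obtain ⟨K, L, hK, hL, -, rfl⟩ := hv
  exact hE.nonneg _ (isChannel_dephasing_comp_tensorMap hΦ hK hL)

theorem inducedPower_eq_zero_iff (hE : IsMeasEntanglingMonotone d E)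
    {Φ : SuperOp (Fin d) (Fin d)} (hΦ : IsChannel Φ) : inducedPower d E Φ = 0 ↔ IsDIO Φ := by
  constructor
  · intro h
    refine isDIO_of_isClosedLOCC hΦ fun e => ?_
    have hch := isChannel_dephasing_comp_tensorMap hΦ isDIO_id (isDIO_conjMap_perm e)
    refine (hE.faithful _ hch).mp (le_antisymm ?_ (hE.nonneg _ hch))
    rw [← h]
    exact le_sSup ⟨_, _, isDIO_id, isDIO_conjMap_perm e, isUnital_conjMap_perm e, rfl⟩
  · intro h
    refine le_antisymm (sSup_le ?_) (inducedPower_nonneg hE hΦ)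
    rintro _ ⟨K, L, hK, hL, -, rfl⟩
    refine ((hE.faithful _ (isChannel_dephasing_comp_tensorMap hΦ hK hL)).mpr ?_).le
    exact (hK.comp (h.tensorMap_id.comp hL)).isLOCC_dephasing_comp.isClosedLOCC

theorem inducedPower_convex (hE : IsMeasEntanglingMonotone d E) {Φ Γ : SuperOp (Fin d) (Fin d)}
    (hΦ : IsChannel Φ) (hΓ : IsChannel Γ) {p : ℝ} (hp0 : 0 ≤ p) (hp1 : p ≤ 1) :
    inducedPower d E ((p : ℂ) • Φ + ((1 - p : ℝ) : ℂ) • Γ) ≤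
      (p : EReal) * inducedPower d E Φ + ((1 - p : ℝ) : EReal) * inducedPower d E Γ := by
  refine sSup_le ?_
  rintro _ ⟨K, L, hK, hL, hL1, rfl⟩
  rw [tensorMap_add_left, tensorMap_smul_left, tensorMap_smul_left, LinearMap.add_comp,
    LinearMap.comp_add, LinearMap.comp_add, LinearMap.smul_comp, LinearMap.smul_comp,
    LinearMap.comp_smul, LinearMap.comp_smul, LinearMap.comp_smul, LinearMap.comp_smul]
  refine (hE.convex _ _ (isChannel_dephasing_comp_tensorMap hΦ hK hL)
    (isChannel_dephasing_comp_tensorMap hΓ hK hL) p hp0 hp1).trans (add_le_add ?_ ?_)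
  · exact mul_le_mul_of_nonneg_left (le_sSup ⟨K, L, hK, hL, hL1, rfl⟩)
      (EReal.coe_nonneg.mpr hp0)
  · exact mul_le_mul_of_nonneg_left (le_sSup ⟨K, L, hK, hL, hL1, rfl⟩)
      (EReal.coe_nonneg.mpr (sub_nonneg.mpr hp1))

theorem inducedPower_mem_inducedValues (hE : IsUSCOnChannels E) {Φ : SuperOp (Fin d) (Fin d)}
    (hΦ : IsChannel Φ) : inducedPower d E Φ ∈ inducedValues d E Φ := by
  obtain ⟨u, -, hu, hmem⟩ :=
    exists_seq_tendsto_sSup (inducedValues_nonempty (E := E) Φ) (OrderTop.bddAbove _)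
  choose Ks Ls hKs hLs hL1s huE using hmem
  -- Two successive extractions make `K` and `L` converge along the common subsequence `φ ∘ ψ` of a
  -- maximising sequence.
  obtain ⟨K, φ, hφ, hK⟩ := exists_subseq_mapsTendTo fun n => (hKs n).1
  obtain ⟨L, ψ, hψ, hL⟩ := exists_subseq_mapsTendTo fun n => (hLs (φ n)).1
  replace hK := hK.subseq hψ
  have hKD : IsDIO K := .of_mapsTendTo (fun n => hKs (φ (ψ n))) hK
  have hLD : IsDIO L := .of_mapsTendTo (fun n => hLs (φ (ψ n))) hL
  have hLU : IsUnital L := .of_mapsTendTo (fun n => hL1s (φ (ψ n))) hL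
  refine ⟨K, L, hKD, hLD, hLU,
    le_antisymm ?_ (le_sSup ⟨K, L, hKD, hLD, hLU, rfl⟩)⟩
  have h := hE _ _
    (fun n => isChannel_dephasing_comp_tensorMap hΦ (hKs (φ (ψ n))) (hLs (φ (ψ n))))
    (isChannel_dephasing_comp_tensorMap hΦ hKD hLD)
    ((mapsTendTo_const _).comp (hK.comp ((mapsTendTo_const _).comp hL)))
  simp only [← huE] at h
  exact (hu.comp (hφ.comp hψ).tendsto_atTop).limsup_eq.symm.le.trans h

end InducedPower

theorem theorem5 (d : ℕ) (hd : 0 < d)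
    (E : SuperOp (Fin d × Fin d) (Fin d × Fin d) → EReal)
    (hE : IsMeasEntanglingMonotone d E) :
    IsMeasCoheringMonotone d (inducedPower d E) ∧
      (IsUSCOnChannels E → ∀ Φ : SuperOp (Fin d) (Fin d), IsChannel Φ →
        IsGreatest (inducedValues d E Φ) (inducedPower d E Φ)) :=
  ⟨{ nonneg := fun _ hΦ => inducedPower_nonneg hE hΦ
     faithful := fun _ hΦ => inducedPower_eq_zero_iff hE hΦ
     monotone := fun Φ _ _ _ hK hL hL1 => sSup_le_sSup (inducedValues_comp_subset Φ hK hL hL1)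
     convex := fun _ _ hΦ hΓ _ hp0 hp1 => inducedPower_convex hE hΦ hΓ hp0 hp1 },
    fun hU _ hΦ => ⟨inducedPower_mem_inducedValues hU hΦ, fun _ hv => le_sSup hv⟩⟩
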